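/- Let $\mathcal H_A,\mathcal H_B$ be separable complex Hilbert spaces and let $G$ be a positive (semidefinite) self-adjoint, densely defined, possibly unbounded operator on $\mathcal H_A$ with $\inf\{\|G\varphi\| : \varphi\in\mathcal D(G),\ \|\varphi\|=1\}=0$. Write $\mathfrak T(\mathcal H)$ for the trace class operators on $\mathcal H$ with the trace norm $\|\cdot\|_1$; a state is a positive operator of unit trace. For an auxiliary separable Hilbert space $\mathcal H_R$ put $\mathcal H_{AR}=\mathcal H_A\otimes\mathcal H_R$, and for an operator $\omega$ on it let $\omega_A=\mathrm{Tr}_R\,\omega$. Let $\mathfrak T_G(\mathcal H_A)$ be the linear span of all states $\rho$ of $\mathcal H_A$ with $\mathrm{Tr}\,G\rho<\infty$, and $\mathfrak T_{G\otimes I_R}(\mathcal H_{AR})$ the linear span of all states $\omega$ of $\mathcal H_{AR}$ with $\mathrm{Tr}\,G\omega_A<\infty$. Let $\mathfrak Y(A,B)$ be the real linear space of all Hermitian-preserving completely bounded linear maps $\mathfrak T(\mathcal H_A)\to\mathfrak T(\mathcal H_B)$. Let $\mathfrak Y_G(A,B)$ be the space of all Hermitian-preserving linear maps $\Phi:\mathfrak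 T_G(\mathcal H_A)\to\mathfrak T(\mathcal H_B)$ such that for every separable $\mathcal H_R$ the map $\Phi\otimes\mathrm{Id}_R$ has a (necessarily unique) linear extension $\mathfrak T_{G\otimes I_R}(\mathcal H_{AR})\to\mathfrak T(\mathcal H_{BR})$, again denoted $\Phi\otimes\mathrm{Id}_R$, that is trace-norm continuous on $\{\omega\ge 0 : \mathrm{Tr}\,\omega\le 1,\ \mathrm{Tr}\,G\omega_A\le E\}$ for every $E>0$. For $\Phi\in\mathfrak Y_G(A,B)$ and $E>0$ the energy-constrained diamond (ECD) norm is $$\|\Phi\|_{\diamond,E}^{G}=\sup\{\|(\Phi\otimes\mathrm{Id}_R)(\omega)\|_1 : \mathcal H_R \text{ separable},\ \omega \text{ a state of } \mathcal H_{AR},\ \mathrm{Tr}\,G\omega_A\le E\}.$$ Let $E_0>0$ and let $\Phi$ belong to the completion of $\mathfrak Y(A,B)$ with respect to the ECD norm $\|\cdot\|_{\diamond,E_0}^{G}$, i.e. to the closure of (the restrictions to $\mathfrak T_G(\mathcal H_A)$ of the maps in) $\mathfrak Y(A,B)$ in the space $\mathfrak Y_G(A,B)$ with this norm. Then $\|\Phi\|_{\diamond,E}^{G}<\infty$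 for all $E>0$, and $$\|\Phi\|_{\diamond,E}^{G}=o(E)\quad\text{as } E\to+\infty .$$ -/

import Mathlib

open scoped TensorProduct ENNReal NNReal InnerProductSpace

namespace ECD

noncomputable section

/-! ### Trace, trace norm and trace class operators -/

section TraceClass

variable {H : Type*} [NormedAddCommGroup H] [InnerProductSpace ℂ H] [CompleteSpace H]

variable (H) in
/-- The index set of a fixed Hilbert (orthonormal) basis of `H`. -/
def basisIndex : Set H := (exists_hilbertBasis ℂ H).choose

variable (H) in
/-- A fixed Hilbert (orthonormal) basis of `H`. -/
def stdBasis : HilbertBasis (basisIndex H) ℂ H :=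
  (exists_hilbertBasis ℂ H).choose_spec.choose

/-- The trace `∑ᵢ ⟨eᵢ, T eᵢ⟩ ∈ [0, ∞]` of a positive bounded operator `T`
(it does not depend on the basis). -/
def posTrace (T : H →L[ℂ] H) : ℝ≥0∞ :=
  ∑' i, ENNReal.ofReal (RCLike.re ⟪stdBasis H i, T (stdBasis H i)⟫_ℂ)

/-- The trace norm `‖T‖₁ = Tr |T| ∈ [0, ∞]` of a bounded operator `T`, with `|T| = √(T* T)`. -/
def traceNorm (T : H →L[ℂ] H) : ℝ≥0∞ := posTrace (CFC.abs T)

theorem norm_abs_apply (T : H →L[ℂ] H) (x : H) : ‖CFC.abs T x‖ = ‖T x‖ := by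
  have hsa : IsSelfAdjoint (CFC.abs T) := (CFC.abs_nonneg T).isSelfAdjoint
  have h1 : ⟪CFC.abs T x, CFC.abs T x⟫_ℂ = ⟪T x, T x⟫_ℂ := by
    have e : CFC.abs T (CFC.abs T x) = (star T * T) x := by
      rw [← CFC.abs_mul_abs T]; rfl
    rw [← ContinuousLinearMap.adjoint_inner_right, ← ContinuousLinearMap.star_eq_adjoint,
      hsa.star_eq, e, ContinuousLinearMap.star_eq_adjoint, mul_apply_eq_comp,
      ContinuousLinearMap.adjoint_inner_right]
  have h2 := congrArg RCLike.re h1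
  rw [← norm_sq_eq_re_inner, ← norm_sq_eq_re_inner] at h2
  exact (sq_eq_sq₀ (norm_nonneg _) (norm_nonneg _)).1 h2

/-- Polar decomposition: `T = W |T|` with a contraction `W`. -/
theorem exists_polar (T : H →L[ℂ] H) :
    ∃ W : H →L[ℂ] H, (∀ x, ‖W x‖ ≤ ‖x‖) ∧ (∀ x, W (CFC.abs T x) = T x) := by
  let K : Submodule ℂ H := (LinearMap.range (CFC.abs T).toLinearMap).topologicalClosure
  have hmem : ∀ x, CFC.abs T x ∈ K := fun x =>
    Submodule.le_topologicalClosure _ ⟨x, rfl⟩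
  let e : H →ₗ[ℂ] K := (CFC.abs T).toLinearMap.codRestrict K hmem
  have hcl : IsClosed (K : Set H) := Submodule.isClosed_topologicalClosure _
  have : CompleteSpace K := hcl.completeSpace_coe
  have hd : DenseRange e := by
    rw [DenseRange, Subtype.dense_iff]
    intro y hy
    refine closure_mono ?_ hy
    rintro _ ⟨x, rfl⟩
    exact ⟨e x, ⟨x, rfl⟩, rfl⟩
  have hn : ∀ x, ‖T.toLinearMap x‖ ≤ 1 * ‖e x‖ := by
    intro x
    rw [one_mul]
    exact (norm_abs_apply T x).ge
  let W₀ : K →L[ℂ] H := T.toLinearMap.extendOfNorm e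
  refine ⟨W₀ ∘L K.orthogonalProjectionOnto, fun x => ?_, fun x => ?_⟩
  · have := LinearMap.norm_extendOfNorm_apply_le hd 1 hn (K.orthogonalProjectionOnto x)
    rw [one_mul] at this
    exact this.trans (K.norm_orthogonalProjectionOnto_apply_le x)
  · have h1 : K.orthogonalProjectionOnto (CFC.abs T x) = e x :=
      Submodule.orthogonalProjectionOnto_mem_subspace_eq_self (e x)
    change W₀ (K.orthogonalProjectionOnto (CFC.abs T x)) = T x
    rw [h1]
    exact LinearMap.extendOfNorm_eq hd ⟨1, hn⟩ x

/-- The squared Hilbert-Schmidt norm. -/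
def hsSq (S : H →L[ℂ] H) : ℝ≥0∞ := ∑' i, ENNReal.ofReal (‖S (stdBasis H i)‖ ^ 2)

theorem parseval (x : H) :
    ∑' i, ENNReal.ofReal (‖⟪stdBasis H i, x⟫_ℂ‖ ^ 2) = ENNReal.ofReal (‖x‖ ^ 2) := by
  have h := (stdBasis H).hasSum_inner_mul_inner x x
  have h2 := h.mapL (RCLike.reCLM : ℂ →L[ℝ] ℝ)
  have h3 : HasSum (fun i => ‖⟪stdBasis H i, x⟫_ℂ‖ ^ 2) (‖x‖ ^ 2) := by
    have e1 : (fun i => ‖⟪stdBasis H i, x⟫_ℂ‖ ^ 2) =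
        fun i => RCLike.re (⟪x, stdBasis H i⟫_ℂ * ⟪stdBasis H i, x⟫_ℂ) := by
      funext i
      rw [← inner_conj_symm x (stdBasis H i), RCLike.conj_mul]
      norm_cast
    rw [e1, norm_sq_eq_re_inner (𝕜 := ℂ)]
    exact h2
  rw [← h3.tsum_eq, ENNReal.ofReal_tsum_of_nonneg (fun _ => by positivity) h3.summable]

theorem hsSq_adjoint (S : H →L[ℂ] H) : hsSq (ContinuousLinearMap.adjoint S) = hsSq S := by
  have key : ∀ X : H →L[ℂ] H, hsSq X = ∑' i, ∑' j,
      ENNReal.ofReal (‖⟪stdBasis H j, X (stdBasis H i)⟫_ℂ‖ ^ 2) := fun X =>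
    tsum_congr fun i => (parseval _).symm
  rw [key, key, ENNReal.tsum_comm]
  refine tsum_congr fun i => tsum_congr fun j => ?_
  rw [ContinuousLinearMap.adjoint_inner_right, norm_inner_symm]

theorem norm_adjoint_apply_le {X : H →L[ℂ] H} (hX : ∀ x, ‖X x‖ ≤ ‖x‖) (x : H) :
    ‖ContinuousLinearMap.adjoint X x‖ ≤ ‖x‖ := by
  have h : ‖ContinuousLinearMap.adjoint X‖ ≤ 1 := by
    rw [LinearIsometryEquiv.norm_map]
    exact X.opNorm_le_bound zero_le_one fun y => by rw [one_mul]; exact hX y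
  simpa using (ContinuousLinearMap.adjoint X).le_of_opNorm_le h x

theorem hsSq_comp_le (S : H →L[ℂ] H) {X : H →L[ℂ] H} (hX : ∀ x, ‖X x‖ ≤ ‖x‖) :
    hsSq (S ∘L X) ≤ hsSq S := by
  rw [← hsSq_adjoint, ← hsSq_adjoint S, ContinuousLinearMap.adjoint_comp]
  refine ENNReal.tsum_le_tsum fun i => ENNReal.ofReal_le_ofReal ?_
  gcongr
  exact norm_adjoint_apply_le hX _

theorem traceNorm_eq_hsSq (T : H →L[ℂ] H) : traceNorm T = hsSq (CFC.sqrt (CFC.abs T)) := by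
  refine tsum_congr fun i => ?_
  have hsa : IsSelfAdjoint (CFC.sqrt (CFC.abs T)) := (CFC.sqrt_nonneg _).isSelfAdjoint
  have e : ∀ x, CFC.abs T x = CFC.sqrt (CFC.abs T) (CFC.sqrt (CFC.abs T) x) := fun x => by
    conv_lhs => rw [← CFC.sqrt_mul_sqrt_self (CFC.abs T) (CFC.abs_nonneg T)]
    rfl
  rw [e, ← ContinuousLinearMap.adjoint_inner_left, ← ContinuousLinearMap.star_eq_adjoint,
    hsa.star_eq, ← norm_sq_eq_re_inner]

theorem tsum_inner_le_traceNorm (T : H →L[ℂ] H) {U : H →L[ℂ] H} (hU : ∀ x, ‖U x‖ ≤ ‖x‖) :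
    ∑' i, ENNReal.ofReal ‖⟪U (stdBasis H i), T (stdBasis H i)⟫_ℂ‖ ≤ traceNorm T := by
  obtain ⟨W, hW, hWT⟩ := exists_polar T
  set S := CFC.sqrt (CFC.abs T) with hS
  set X : H →L[ℂ] H := ContinuousLinearMap.adjoint W ∘L U with hXdef
  have hX : ∀ x, ‖X x‖ ≤ ‖x‖ := fun x => (norm_adjoint_apply_le hW _).trans (hU x)
  have hsa : IsSelfAdjoint S := (CFC.sqrt_nonneg _).isSelfAdjoint
  have e : ∀ x, T x = W (S (S x)) := fun x => by
    rw [← hWT x]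
    congr 1
    conv_lhs => rw [← CFC.sqrt_mul_sqrt_self (CFC.abs T) (CFC.abs_nonneg T)]
    rfl
  have bound : ∀ x, ‖⟪U x, T x⟫_ℂ‖ ≤ (‖(S ∘L X) x‖ ^ 2 + ‖S x‖ ^ 2) / 2 := fun x => by
    have h1 : ⟪U x, T x⟫_ℂ = ⟪(S ∘L X) x, S x⟫_ℂ := by
      rw [e, ← ContinuousLinearMap.adjoint_inner_left, ← ContinuousLinearMap.adjoint_inner_left,
        ← ContinuousLinearMap.star_eq_adjoint (A := S), hsa.star_eq]
      rfl
    rw [h1]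
    have h2 := norm_inner_le_norm (𝕜 := ℂ) ((S ∘L X) x) (S x)
    nlinarith [sq_nonneg (‖(S ∘L X) x‖ - ‖S x‖)]
  calc ∑' i, ENNReal.ofReal ‖⟪U (stdBasis H i), T (stdBasis H i)⟫_ℂ‖
      ≤ ∑' i, (ENNReal.ofReal (‖(S ∘L X) (stdBasis H i)‖ ^ 2)
          + ENNReal.ofReal (‖S (stdBasis H i)‖ ^ 2)) / 2 := by
        refine ENNReal.tsum_le_tsum fun i => ?_
        refine (ENNReal.ofReal_le_ofReal (bound _)).trans ?_
        rw [ENNReal.ofReal_div_of_pos two_pos, ENNReal.ofReal_add (by positivity) (by positivity)]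
        simp
    _ = (hsSq (S ∘L X) + hsSq S) / 2 := by
        simp only [div_eq_mul_inv]
        rw [ENNReal.tsum_mul_right, ENNReal.tsum_add]
        rfl
    _ ≤ (hsSq S + hsSq S) / 2 := by
        gcongr
        exact hsSq_comp_le S hX
    _ = traceNorm T := by
        rw [traceNorm_eq_hsSq, ← two_mul, mul_comm, ENNReal.mul_div_cancel_right two_ne_zero
          ENNReal.ofNat_ne_top]

theorem traceNorm_add_le (A B : H →L[ℂ] H) :
    traceNorm (A + B) ≤ traceNorm A + traceNorm B := by
  obtain ⟨W, hW, hWT⟩ := exists_polar (A + B)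
  have hiso : ∀ x, ⟪x, CFC.abs (A + B) x⟫_ℂ = ⟪W x, (A + B) x⟫_ℂ := fun x => by
    set y := CFC.abs (A + B) x with hy
    have h1 : ‖W y‖ = ‖y‖ := by rw [hWT, hy, norm_abs_apply]
    have h2 : ‖ContinuousLinearMap.adjoint W (W y) - y‖ ^ 2 ≤ 0 := by
      rw [norm_sub_sq (𝕜 := ℂ), ContinuousLinearMap.adjoint_inner_left, ← norm_sq_eq_re_inner, h1]
      have h3 := norm_adjoint_apply_le hW (W y)
      rw [h1] at h3
      nlinarith [norm_nonneg (ContinuousLinearMap.adjoint W (W y)), norm_nonneg y]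
    have h4 : ContinuousLinearMap.adjoint W (W y) = y := by
      rw [← sub_eq_zero, ← norm_eq_zero]
      exact pow_eq_zero_iff two_ne_zero |>.1 (le_antisymm h2 (sq_nonneg _))
    rw [← hWT, ← hy, ← ContinuousLinearMap.adjoint_inner_right, h4]
  calc traceNorm (A + B)
      ≤ ∑' i, (ENNReal.ofReal ‖⟪W (stdBasis H i), A (stdBasis H i)⟫_ℂ‖
          + ENNReal.ofReal ‖⟪W (stdBasis H i), B (stdBasis H i)⟫_ℂ‖) := by
        refine ENNReal.tsum_le_tsum fun i => ?_
        rw [hiso, ← ENNReal.ofReal_add (norm_nonneg _) (norm_nonneg _)]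
        refine ENNReal.ofReal_le_ofReal ((RCLike.re_le_norm _).trans ?_)
        rw [add_apply, inner_add_right]
        exact norm_add_le _ _
    _ ≤ traceNorm A + traceNorm B := by
        rw [ENNReal.tsum_add]
        exact add_le_add (tsum_inner_le_traceNorm A hW) (tsum_inner_le_traceNorm B hW)

theorem traceNorm_smul (c : ℂ) (T : H →L[ℂ] H) :
    traceNorm (c • T) = ENNReal.ofReal ‖c‖ * traceNorm T := by
  rw [traceNorm, traceNorm, CFC.abs_smul, posTrace, posTrace, ← ENNReal.tsum_mul_left]
  refine tsum_congr fun i => ?_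
  rw [← ENNReal.ofReal_mul (norm_nonneg c)]
  congr 1
  rw [smul_apply, RCLike.real_smul_eq_coe_smul (K := ℂ), inner_smul_right, RCLike.re_ofReal_mul]

theorem traceNorm_zero : traceNorm (0 : H →L[ℂ] H) = 0 := by
  have h := traceNorm_smul (0 : ℂ) (0 : H →L[ℂ] H)
  simpa using h

theorem traceNorm_of_nonneg {T : H →L[ℂ] H} (hT : 0 ≤ T) : traceNorm T = posTrace T := by
  rw [traceNorm, CFC.abs_of_nonneg T hT]

variable (H) in
/-- The space `𝔗(H)` of trace class operators on `H`. -/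
def TraceClass : Submodule ℂ (H →L[ℂ] H) where
  carrier := {T | traceNorm T < ∞}
  add_mem' hA hB := (traceNorm_add_le _ _).trans_lt (ENNReal.add_lt_top.2 ⟨hA, hB⟩)
  zero_mem' := by simp [traceNorm_zero]
  smul_mem' c T hT := by
    change traceNorm (c • T) < ∞
    rw [traceNorm_smul]
    exact ENNReal.mul_lt_top ENNReal.ofReal_lt_top hT

/-- Quantum states: positive operators with unit trace. -/
def IsState (ρ : H →L[ℂ] H) : Prop := ρ.IsPositive ∧ posTrace ρ = 1

theorem IsState.mem_traceClass {ρ : H →L[ℂ] H} (hρ : IsState ρ) : ρ ∈ TraceClass H := by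
  change traceNorm ρ < ∞
  rw [traceNorm_of_nonneg ((ContinuousLinearMap.nonneg_iff_isPositive ρ).2 hρ.1), hρ.2]
  exact ENNReal.one_lt_top

end TraceClass

/-! ### Composite systems -/

section Tensor

variable (A R : Type*) [NormedAddCommGroup A] [InnerProductSpace ℂ A]
  [NormedAddCommGroup R] [InnerProductSpace ℂ R]

/-- The Hilbert space tensor product: the completion of the algebraic tensor product. -/
abbrev HTensor : Type _ := UniformSpace.Completion (A ⊗[ℂ] R)

variable {A R}

/-- The operator `ρ ⊗ σ` on the Hilbert space tensor product. -/
def tensorOp (ρ : A →L[ℂ] A) (σ : R →L[ℂ] R) : HTensor A R →L[ℂ] HTensor A R :=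
  (TensorProduct.mapL ρ σ).completion

/-- The bounded operator `φ ↦ φ ⊗ f` from `A` to the Hilbert space tensor product. -/
def tmulRight (f : R) : A →L[ℂ] HTensor A R :=
  (UniformSpace.Completion.toComplL (𝕜 := ℂ) (E := A ⊗[ℂ] R)) ∘L (TensorProduct.mkL ℂ A R).flip f

/-- The partial trace over `R`: `ω_A = ∑ⱼ Vⱼ* ω Vⱼ` with `Vⱼ φ = φ ⊗ fⱼ` for an orthonormal basis
`(fⱼ)` of `R`; the series converges in norm for every trace class `ω`. -/
def partialTrace [CompleteSpace A] [CompleteSpace R]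
    (ω : HTensor A R →L[ℂ] HTensor A R) : A →L[ℂ] A :=
  ∑' j, (ContinuousLinearMap.adjoint (tmulRight (stdBasis R j))) ∘L ω ∘L
    (tmulRight (stdBasis R j))

end Tensor

/-! ### Energy -/

section Energy

variable {A : Type*} [NormedAddCommGroup A] [InnerProductSpace ℂ A] [CompleteSpace A]

/-- `Tr Gρ ∈ [0, ∞]` for a positive self-adjoint (unbounded) operator `G` and a positive `ρ`:
the supremum of `Tr Kρ = Tr √K ρ √K` over all bounded positive operators `K ≤ G` (in the sense of
quadratic forms on the domain of `G`). The truncations `G Pₙ` with the spectral projectors `Pₙ` of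
`G` onto `[0, n]` are such operators, and they already give the supremum. -/
def energy (G : A →ₗ.[ℂ] A) (ρ : A →L[ℂ] A) : ℝ≥0∞ :=
  ⨆ (K : A →L[ℂ] A) (_ : K.IsPositive)
    (_ : ∀ φ : G.domain, RCLike.re ⟪(φ : A), K φ⟫_ℂ ≤ RCLike.re ⟪(φ : A), G φ⟫_ℂ),
    posTrace (CFC.sqrt K ∘L ρ ∘L CFC.sqrt K)

/-- A positive (semidefinite) self-adjoint operator whose spectrum has infimum zero. -/
structure IsHamiltonian (G : A →ₗ.[ℂ] A) : Prop where
  selfAdjoint : IsSelfAdjoint G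
  nonneg : ∀ φ : G.domain, 0 ≤ RCLike.re ⟪(φ : A), G φ⟫_ℂ
  inf_eq_zero : ∀ ε > 0, ∃ φ : G.domain, ‖(φ : A)‖ = 1 ∧ ‖G φ‖ < ε

/-- The linear span `𝔗_G(A)` of all states of `A` with finite energy. -/
def FiniteEnergy (G : A →ₗ.[ℂ] A) : Submodule ℂ (A →L[ℂ] A) :=
  Submodule.span ℂ {ρ | IsState ρ ∧ energy G ρ < ∞}

theorem finiteEnergy_le (G : A →ₗ.[ℂ] A) : FiniteEnergy G ≤ TraceClass A :=
  Submodule.span_le.2 fun _ h => h.1.mem_traceClass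

/-- The linear span `𝔗_{G ⊗ I_R}(AR)` of all states `ω` of `AR` with `Tr G ω_A < ∞`. -/
def FiniteEnergyAR (G : A →ₗ.[ℂ] A) (R : Type*) [NormedAddCommGroup R] [InnerProductSpace ℂ R]
    [CompleteSpace R] : Submodule ℂ (HTensor A R →L[ℂ] HTensor A R) :=
  Submodule.span ℂ {ω | IsState ω ∧ energy G (partialTrace ω) < ∞}

/-- The set `ℭ_{G ⊗ I_R, E}` of positive `ω` on `AR` with `Tr ω ≤ 1` and `Tr G ω_A ≤ E`. -/
def EnergyBall (G : A →ₗ.[ℂ] A) (R : Type*) [NormedAddCommGroup R] [InnerProductSpace ℂ R]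
    [CompleteSpace R] (E : ℝ) : Set (HTensor A R →L[ℂ] HTensor A R) :=
  {ω | ω.IsPositive ∧ posTrace ω ≤ 1 ∧ energy G (partialTrace ω) ≤ ENNReal.ofReal E}

end Energy

/-! ### Maps -/

section Maps

variable {A B : Type*} [NormedAddCommGroup A] [InnerProductSpace ℂ A] [CompleteSpace A]
  [NormedAddCommGroup B] [InnerProductSpace ℂ B] [CompleteSpace B]

/-- `Φ` is Hermitian-preserving: `Φ(ρ*) = Φ(ρ)*`. -/
def HermitianPreserving {S : Submodule ℂ (A →L[ℂ] A)} (Φ : S →ₗ[ℂ] TraceClass B) : Prop :=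
  ∀ ρ ρ' : S, (ρ' : A →L[ℂ] A) = star (ρ : A →L[ℂ] A) →
    (Φ ρ' : B →L[ℂ] B) = star (Φ ρ : B →L[ℂ] B)

/-- `Θ` is a linear extension of `Φ ⊗ Id_R`, i.e. `Θ(ρ ⊗ σ) = Φ(ρ) ⊗ σ`. -/
def ExtendsTensorId {R : Type*} [NormedAddCommGroup R] [InnerProductSpace ℂ R] [CompleteSpace R]
    {S : Submodule ℂ (A →L[ℂ] A)} {S' : Submodule ℂ (HTensor A R →L[ℂ] HTensor A R)}
    (Φ : S →ₗ[ℂ] TraceClass B) (Θ : S' →ₗ[ℂ] TraceClass (HTensor B R)) : Prop :=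
  ∀ (ρ : S) (σ : TraceClass R) (ω : S'),
    (ω : HTensor A R →L[ℂ] HTensor A R) = tensorOp (ρ : A →L[ℂ] A) (σ : R →L[ℂ] R) →
    (Θ ω : HTensor B R →L[ℂ] HTensor B R) = tensorOp (Φ ρ : B →L[ℂ] B) (σ : R →L[ℂ] R)

/-- `Φ : 𝔗(A) → 𝔗(B)` is completely bounded: there is a constant `C` such that for every separable
`R` the map `Φ ⊗ Id_R` extends to `𝔗(AR)` with norm at most `C` with respect to the trace norms. -/
def CompletelyBounded (Φ : TraceClass A →ₗ[ℂ] TraceClass B) : Prop :=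
  ∃ C : ℝ≥0, ∀ (R : Type) [NormedAddCommGroup R] [InnerProductSpace ℂ R] [CompleteSpace R]
    [TopologicalSpace.SeparableSpace R],
    ∃ Θ : TraceClass (HTensor A R) →ₗ[ℂ] TraceClass (HTensor B R), ExtendsTensorId Φ Θ ∧
      ∀ ω, traceNorm (Θ ω : HTensor B R →L[ℂ] HTensor B R) ≤
        C * traceNorm (ω : HTensor A R →L[ℂ] HTensor A R)

variable (A B) in
/-- The set `𝔜(A, B)` of Hermitian-preserving completely bounded maps `𝔗(A) → 𝔗(B)`. -/
def Y : Set (TraceClass A →ₗ[ℂ] TraceClass B) :=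
  {Φ | HermitianPreserving Φ ∧ CompletelyBounded Φ}

/-- `Θ` is the extension of `Φ ⊗ Id_R` to `𝔗_{G ⊗ I_R}(AR)` that is continuous (in the trace norm)
on every set `ℭ_{G ⊗ I_R, E}`, `E > 0`. Such an extension is unique. -/
structure IsContExtension {R : Type*} [NormedAddCommGroup R] [InnerProductSpace ℂ R]
    [CompleteSpace R] (G : A →ₗ.[ℂ] A) (Φ : FiniteEnergy G →ₗ[ℂ] TraceClass B)
    (Θ : FiniteEnergyAR G R →ₗ[ℂ] TraceClass (HTensor B R)) : Prop where
  extends_tensor : ExtendsTensorId Φ Θ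
  continuous : ∀ E > 0, ∀ ω : FiniteEnergyAR G R,
    (ω : HTensor A R →L[ℂ] HTensor A R) ∈ EnergyBall G R E → ∀ ε > 0, ∃ δ > 0,
    ∀ ω' : FiniteEnergyAR G R, (ω' : HTensor A R →L[ℂ] HTensor A R) ∈ EnergyBall G R E →
      traceNorm ((ω' - ω : FiniteEnergyAR G R) : HTensor A R →L[ℂ] HTensor A R) < δ →
      traceNorm ((Θ ω' - Θ ω : TraceClass (HTensor B R)) : HTensor B R →L[ℂ] HTensor B R) < ε

/-- The space `𝔜_G(A, B)`: Hermitian-preserving linear maps `Φ : 𝔗_G(A) → 𝔗(B)` such that for every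
separable `R` the map `Φ ⊗ Id_R` has a linear extension to `𝔗_{G ⊗ I_R}(AR)` that is continuous on
every `ℭ_{G ⊗ I_R, E}`. -/
def YG (B : Type*) [NormedAddCommGroup B] [InnerProductSpace ℂ B] [CompleteSpace B]
    (G : A →ₗ.[ℂ] A) : Set (FiniteEnergy G →ₗ[ℂ] TraceClass B) :=
  {Φ | HermitianPreserving Φ ∧
    ∀ (R : Type) [NormedAddCommGroup R] [InnerProductSpace ℂ R] [CompleteSpace R]
      [TopologicalSpace.SeparableSpace R],
      ∃ Θ : FiniteEnergyAR G R →ₗ[ℂ] TraceClass (HTensor B R), IsContExtension G Φ Θ}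

/-- The restriction of a map on `𝔗(A)` to `𝔗_G(A)`. -/
def restrict (G : A →ₗ.[ℂ] A) (Φ : TraceClass A →ₗ[ℂ] TraceClass B) :
    FiniteEnergy G →ₗ[ℂ] TraceClass B :=
  Φ ∘ₗ Submodule.inclusion (finiteEnergy_le G)

/-- The energy-constrained diamond norm of `Φ ∈ 𝔜_G(A, B)`, with values in `[0, ∞]`: the supremum of
`‖(Φ ⊗ Id_R)(ω)‖₁` over all separable `R` and all states `ω` of `AR` with `Tr G ω_A ≤ E`. -/
def ecdNorm (G : A →ₗ.[ℂ] A) (E : ℝ) (Φ : FiniteEnergy G →ₗ[ℂ] TraceClass B) : ℝ≥0∞ :=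
  sSup {x | ∃ (R : Type) (_ : NormedAddCommGroup R) (_ : InnerProductSpace ℂ R)
    (_ : CompleteSpace R) (_ : TopologicalSpace.SeparableSpace R)
    (Θ : FiniteEnergyAR G R →ₗ[ℂ] TraceClass (HTensor B R)) (ω : FiniteEnergyAR G R),
    IsContExtension G Φ Θ ∧ IsState (ω : HTensor A R →L[ℂ] HTensor A R) ∧
    energy G (partialTrace (ω : HTensor A R →L[ℂ] HTensor A R)) ≤ ENNReal.ofReal E ∧
    x = traceNorm (Θ ω : HTensor B R →L[ℂ] HTensor B R)}

/-- The completion of `𝔜(A, B)` with respect to the norm `‖·‖_{⋄,E₀}^G`: its closure in the Banach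
space `𝔜_G(A, B)`, i.e. the set of the maps in `𝔜_G(A, B)` that are limits of sequences of maps
in `𝔜(A, B)`. -/
def YCompletion (B : Type*) [NormedAddCommGroup B] [InnerProductSpace ℂ B] [CompleteSpace B]
    (G : A →ₗ.[ℂ] A) (E₀ : ℝ) : Set (FiniteEnergy G →ₗ[ℂ] TraceClass B) :=
  {Φ | Φ ∈ YG B G ∧ ∃ Ψ : ℕ → (TraceClass A →ₗ[ℂ] TraceClass B), (∀ n, Ψ n ∈ Y A B) ∧
    Filter.Tendsto (fun n => ecdNorm G E₀ (Φ - restrict G (Ψ n))) Filter.atTop (nhds 0)}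

end Maps

end

end ECD

/-!
Why the theorem holds: let `Ψₙ ∈ 𝔜(A, B)` approximate `Φ` in the norm `‖·‖_{⋄,E₀}`. The triangle
inequality gives `‖Φ‖_{⋄,E} ≤ Cₙ + ‖Φ - Ψₙ‖_{⋄,E}`, where `Cₙ` is a bound for the completely bounded
map `Ψₙ` and does not depend on `E` (`ecdNorm_le_add_ecdNorm_sub`). On the other hand, an ECD norm
grows at most linearly, `‖Ψ‖_{⋄,E} ≤ (4 (E + E₀) / E₀) ‖Ψ‖_{⋄,E₀}` (`ecdNorm_le_mul_ecdNorm`). Thus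
`limsup ‖Φ‖_{⋄,E} / E ≤ (4 / E₀) ‖Φ - Ψₙ‖_{⋄,E₀}` for every `n`, and the right-hand side tends to
zero.

The linear growth comes from mixing a state `ω` of energy at most `E` with a product vector state
`ω₀` whose energy is at most `E₀ / 2`; `ω₀` exists since the spectrum of `G` has infimum zero. With
the weight `p = E₀ / (2 (E + E₀))` the state `p ω + (1 - p) ω₀` has energy at most `E₀`, and
`p Θ(ω)` is the difference of the values of `Θ` on this mixture and on `(1 - p) ω₀`.
Convexity of the energy of the reduced state requires the partial trace to be additive on states,
i.e. the defining series to converge in operator norm (`IsState.summable_partialTrace`). This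
follows from Bessel's inequality for the orthonormal system `eᵢ ⊗ fⱼ`.
-/

namespace ECD

/-! ### Trace and Hilbert-Schmidt norm -/

section Trace

theorem bessel {H : Type*} [NormedAddCommGroup H] [InnerProductSpace ℂ H]
    {ι : Type*} {u : ι → H} (hu : Orthonormal ℂ u) (x : H) :
    ∑' k, ENNReal.ofReal (‖⟪u k, x⟫_ℂ‖ ^ 2) ≤ ENNReal.ofReal (‖x‖ ^ 2) := by
  rw [← ENNReal.ofReal_tsum_of_nonneg (fun _ => by positivity) (hu.inner_products_summable x)]
  exact ENNReal.ofReal_le_ofReal (hu.tsum_inner_products_le x)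

variable {H : Type*} [NormedAddCommGroup H] [InnerProductSpace ℂ H] [CompleteSpace H]

theorem posTrace_add_le (S T : H →L[ℂ] H) : posTrace (S + T) ≤ posTrace S + posTrace T := by
  rw [posTrace, posTrace, posTrace, ← ENNReal.tsum_add]
  refine ENNReal.tsum_le_tsum fun i => ?_
  rw [add_apply, inner_add_right, map_add]
  exact ENNReal.ofReal_add_le

theorem posTrace_add {S T : H →L[ℂ] H} (hS : S.IsPositive) (hT : T.IsPositive) :
    posTrace (S + T) = posTrace S + posTrace T := by
  rw [posTrace, posTrace, posTrace, ← ENNReal.tsum_add]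
  refine tsum_congr fun i => ?_
  rw [add_apply, inner_add_right, map_add]
  exact ENNReal.ofReal_add (hS.re_inner_nonneg_right _) (hT.re_inner_nonneg_right _)

theorem posTrace_smul {p : ℝ} (hp : 0 ≤ p) (T : H →L[ℂ] H) :
    posTrace ((p : ℂ) • T) = ENNReal.ofReal p * posTrace T := by
  rw [posTrace, posTrace, ← ENNReal.tsum_mul_left]
  refine tsum_congr fun i => ?_
  rw [← ENNReal.ofReal_mul hp]
  congr 1
  rw [smul_apply, inner_smul_right]
  exact RCLike.re_ofReal_mul p _

theorem posTrace_rankOne (x : H) :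
    posTrace (InnerProductSpace.rankOne ℂ x x) = ENNReal.ofReal (‖x‖ ^ 2) := by
  rw [← parseval]
  refine tsum_congr fun i => ?_
  rw [InnerProductSpace.rankOne_apply, inner_smul_right, ← inner_conj_symm x (stdBasis H i),
    RCLike.conj_mul]
  norm_cast

theorem isState_rankOne {x : H} (hx : ‖x‖ = 1) : IsState (InnerProductSpace.rankOne ℂ x x) :=
  ⟨InnerProductSpace.isPositive_rankOne_self x, by simp [posTrace_rankOne, hx]⟩

theorem IsState.mix {ρ σ : H →L[ℂ] H} (hρ : IsState ρ) (hσ : IsState σ) {p q : ℝ}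
    (hp : 0 ≤ p) (hq : 0 ≤ q) (hpq : p + q = 1) : IsState ((p : ℂ) • ρ + (q : ℂ) • σ) := by
  have h1 : ((p : ℂ) • ρ).IsPositive := hρ.1.smul_of_nonneg (by exact_mod_cast hp)
  have h2 : ((q : ℂ) • σ).IsPositive := hσ.1.smul_of_nonneg (by exact_mod_cast hq)
  refine ⟨h1.add h2, ?_⟩
  rw [posTrace_add h1 h2, posTrace_smul hp, posTrace_smul hq, hρ.2, hσ.2, mul_one, mul_one,
    ← ENNReal.ofReal_add hp hq, hpq, ENNReal.ofReal_one]

theorem exists_sqrt_of_isPositive {T : H →L[ℂ] H} (hT : T.IsPositive) :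
    ∃ S : H →L[ℂ] H, ContinuousLinearMap.adjoint S = S ∧ S ∘L S = T ∧ hsSq S = posTrace T := by
  have h := (ContinuousLinearMap.nonneg_iff_isPositive T).2 hT
  refine ⟨CFC.sqrt T, (CFC.sqrt_nonneg T).isSelfAdjoint.star_eq, CFC.sqrt_mul_sqrt_self T h, ?_⟩
  rw [← traceNorm_of_nonneg h, traceNorm_eq_hsSq, CFC.abs_of_nonneg T h]

theorem norm_adjoint_comp_sq_comp {K : Type*} [NormedAddCommGroup K] [InnerProductSpace ℂ K]
    [CompleteSpace K] {S : H →L[ℂ] H} (hS : ContinuousLinearMap.adjoint S = S) (V : K →L[ℂ] H) :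
    ‖ContinuousLinearMap.adjoint V ∘L (S ∘L S) ∘L V‖ = ‖S ∘L V‖ ^ 2 := by
  rw [sq, ← ContinuousLinearMap.norm_adjoint_comp_self, ContinuousLinearMap.adjoint_comp, hS]
  rfl

theorem traceNorm_sub_le (S T : H →L[ℂ] H) : traceNorm (S - T) ≤ traceNorm S + traceNorm T := by
  have h := traceNorm_add_le S ((-1 : ℂ) • T)
  rwa [traceNorm_smul, norm_neg, norm_one, ENNReal.ofReal_one, one_mul, neg_one_smul,
    ← sub_eq_add_neg] at h

/-- The inverse of mixing: the first of two operators is controlled by a mixture of them and the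
second one. -/
theorem traceNorm_le_of_mix (S T : H →L[ℂ] H) {p : ℝ} (hp0 : 0 < p) (hp1 : p ≤ 1) :
    traceNorm S ≤ ENNReal.ofReal p⁻¹ *
      (traceNorm ((p : ℂ) • S + ((1 - p : ℝ) : ℂ) • T) + traceNorm T) := by
  have hpc0 : (p : ℂ) ≠ 0 := by exact_mod_cast hp0.ne'
  have h : S = ((p⁻¹ : ℝ) : ℂ) •
      (((p : ℂ) • S + ((1 - p : ℝ) : ℂ) • T) + ((-(1 - p) : ℝ) : ℂ) • T) := by
    rw [add_assoc, ← add_smul, ← Complex.ofReal_add, add_neg_cancel, Complex.ofReal_zero,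
      zero_smul, add_zero, smul_smul, Complex.ofReal_inv, inv_mul_cancel₀ hpc0, one_smul]
  conv_lhs => rw [h]
  rw [traceNorm_smul, Complex.norm_real, Real.norm_of_nonneg (inv_pos.2 hp0).le]
  gcongr
  refine (traceNorm_add_le _ _).trans (add_le_add le_rfl ?_)
  rw [traceNorm_smul, Complex.norm_real, norm_neg, Real.norm_of_nonneg (sub_nonneg.2 hp1)]
  exact mul_le_of_le_one_left' (ENNReal.ofReal_le_one.2 (by linarith))

/-- The Hilbert-Schmidt norm dominates the sum over any orthonormal system, not only over the
basis that defines it. -/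
theorem tsum_norm_sq_le_hsSq {ι : Type*} {u : ι → H} (hu : Orthonormal ℂ u) (S : H →L[ℂ] H) :
    ∑' k, ENNReal.ofReal (‖S (u k)‖ ^ 2) ≤ hsSq S := by
  calc ∑' k, ENNReal.ofReal (‖S (u k)‖ ^ 2)
      = ∑' k, ∑' m, ENNReal.ofReal (‖⟪stdBasis H m, S (u k)⟫_ℂ‖ ^ 2) :=
        tsum_congr fun k => (parseval _).symm
    _ = ∑' m, ∑' k, ENNReal.ofReal
          (‖⟪u k, ContinuousLinearMap.adjoint S (stdBasis H m)⟫_ℂ‖ ^ 2) := by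
        rw [ENNReal.tsum_comm]
        refine tsum_congr fun m => tsum_congr fun k => ?_
        rw [ContinuousLinearMap.adjoint_inner_right, norm_inner_symm]
    _ ≤ hsSq (ContinuousLinearMap.adjoint S) := ENNReal.tsum_le_tsum fun m => bessel hu _
    _ = hsSq S := hsSq_adjoint S

/-- The operator norm is at most the Hilbert-Schmidt norm. -/
theorem ofReal_opNorm_sq_le_tsum {K : Type*} [NormedAddCommGroup K] [InnerProductSpace ℂ K]
    [CompleteSpace K] (T : H →L[ℂ] K) :
    ENNReal.ofReal (‖T‖ ^ 2) ≤ ∑' i, ENNReal.ofReal (‖T (stdBasis H i)‖ ^ 2) := by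
  set c := ∑' i, ENNReal.ofReal (‖T (stdBasis H i)‖ ^ 2) with hc
  rcases eq_or_ne c ∞ with h | h
  · rw [h]; exact le_top
  have key : ∀ y, ‖ContinuousLinearMap.adjoint T y‖ ^ 2 ≤ c.toReal * ‖y‖ ^ 2 := fun y => by
    rw [← ENNReal.ofReal_le_ofReal_iff (by positivity), ENNReal.ofReal_mul ENNReal.toReal_nonneg,
      ENNReal.ofReal_toReal h, ← parseval, hc, ← ENNReal.tsum_mul_right]
    refine ENNReal.tsum_le_tsum fun i => ?_
    rw [← ENNReal.ofReal_mul (by positivity), ContinuousLinearMap.adjoint_inner_right, ← mul_pow]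
    exact ENNReal.ofReal_le_ofReal (pow_le_pow_left₀ (norm_nonneg _) (norm_inner_le_norm _ _) 2)
  have hn : ‖T‖ ≤ √c.toReal := by
    rw [← LinearIsometryEquiv.norm_map ContinuousLinearMap.adjoint T]
    refine ContinuousLinearMap.opNorm_le_bound _ (Real.sqrt_nonneg _) fun y => ?_
    rw [← abs_of_nonneg (norm_nonneg (ContinuousLinearMap.adjoint T y)),
      ← abs_of_nonneg (mul_nonneg (Real.sqrt_nonneg c.toReal) (norm_nonneg y)), ← sq_le_sq,
      mul_pow, Real.sq_sqrt ENNReal.toReal_nonneg]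
    exact key y
  refine (ENNReal.ofReal_le_ofReal ?_).trans_eq (ENNReal.ofReal_toReal h)
  rw [← Real.sq_sqrt (ENNReal.toReal_nonneg (a := c))]
  exact pow_le_pow_left₀ (norm_nonneg _) hn 2

end Trace

/-! ### Partial trace -/

section PartialTrace

variable {A R : Type*} [NormedAddCommGroup A] [InnerProductSpace ℂ A]
  [NormedAddCommGroup R] [InnerProductSpace ℂ R]

theorem inner_tmulRight (φ ψ : A) (f g : R) :
    ⟪tmulRight f φ, tmulRight g ψ⟫_ℂ = ⟪φ, ψ⟫_ℂ * ⟪f, g⟫_ℂ := by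
  change ⟪((φ ⊗ₜ[ℂ] f : A ⊗[ℂ] R) : HTensor A R), ((ψ ⊗ₜ[ℂ] g : A ⊗[ℂ] R) : HTensor A R)⟫_ℂ = _
  rw [UniformSpace.Completion.inner_coe, TensorProduct.inner_tmul]

theorem orthonormal_tmulRight {ι κ : Type*} {e : ι → A} {f : κ → R} (he : Orthonormal ℂ e)
    (hf : Orthonormal ℂ f) : Orthonormal ℂ fun k : κ × ι => tmulRight (f k.1) (e k.2) := by
  classical
  rw [orthonormal_iff_ite] at *
  rintro ⟨j, i⟩ ⟨j', i'⟩
  rw [inner_tmulRight, he, hf]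
  by_cases h1 : j = j' <;> by_cases h2 : i = i' <;> simp [h1, h2]

/-- Linearity in the first factor; by density it is enough to check it on the algebraic tensor
product. -/
theorem tensorOp_sub (ρ ρ' : A →L[ℂ] A) (σ : R →L[ℂ] R) :
    tensorOp (ρ - ρ') σ = tensorOp ρ σ - tensorOp ρ' σ := by
  refine ContinuousLinearMap.ext fun x => ?_
  refine UniformSpace.Completion.induction_on x
    (isClosed_eq (ContinuousLinearMap.continuous _) (ContinuousLinearMap.continuous _)) fun a => ?_
  rw [sub_apply]
  simp only [tensorOp, ContinuousLinearMap.completion_apply_coe]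
  rw [← UniformSpace.Completion.coe_sub]
  congr 1
  induction a with
  | zero => simp
  | tmul x y => simp [TensorProduct.sub_tmul]
  | add x y hx hy => rw [map_add, hx, hy, map_add, map_add]; abel

theorem IsState.nonempty_basisIndex [CompleteSpace R] {ω : HTensor A R →L[ℂ] HTensor A R}
    (hω : IsState ω) : Nonempty (basisIndex R) := by
  by_contra hne
  rw [not_nonempty_iff] at hne
  have hR : Subsingleton R := ⟨fun x y => (stdBasis R).repr.injective (by ext i; exact hne.elim i)⟩
  have hT : ∀ x : HTensor A R, x = 0 := fun x => by
    refine UniformSpace.Completion.induction_on x (isClosed_singleton (x := 0)) fun a => ?_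
    rw [Subsingleton.elim a 0]
    rfl
  have h1 := hω.2
  rw [show ω = 0 from ContinuousLinearMap.ext fun x => hT _] at h1
  simp [posTrace] at h1

variable [CompleteSpace A]

theorem adjoint_tmulRight_apply_tmulRight (f g : R) (φ : A) :
    ContinuousLinearMap.adjoint (tmulRight f) (tmulRight g φ) = ⟪f, g⟫_ℂ • φ := by
  refine ext_inner_left ℂ fun ψ => ?_
  rw [ContinuousLinearMap.adjoint_inner_right, inner_tmulRight, inner_smul_right, mul_comm]

variable [CompleteSpace R]

/-- The partial trace of a state is not a junk value: the norms of the terms of the series are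
bounded by the sums of `‖√ω (eᵢ ⊗ fⱼ)‖²` over `i`, and these sums add up to at most `Tr ω`. -/
theorem IsState.summable_partialTrace {ω : HTensor A R →L[ℂ] HTensor A R} (hω : IsState ω) :
    Summable fun j => (ContinuousLinearMap.adjoint (tmulRight (A := A) (stdBasis R j))) ∘L ω ∘L
      (tmulRight (stdBasis R j)) := by
  obtain ⟨S, hsa, hSS, hS⟩ := exists_sqrt_of_isPositive hω.1
  refine Summable.of_norm ?_
  have hterm : ∀ j, ‖(ContinuousLinearMap.adjoint (tmulRight (A := A) (stdBasis R j))) ∘L ω ∘L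
      (tmulRight (stdBasis R j))‖ = ‖S ∘L tmulRight (A := A) (stdBasis R j)‖ ^ 2 := fun j => by
    rw [← hSS]
    exact norm_adjoint_comp_sq_comp hsa _
  refine Summable.congr ?_ fun j => (hterm j).symm
  have hle : ∑' j, ENNReal.ofReal (‖S ∘L tmulRight (A := A) (stdBasis R j)‖ ^ 2) ≤ 1 := by
    calc _ ≤ ∑' j, ∑' i, ENNReal.ofReal (‖S (tmulRight (stdBasis R j) (stdBasis A i))‖ ^ 2) :=
          ENNReal.tsum_le_tsum fun j => ofReal_opNorm_sq_le_tsum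
            (S ∘L tmulRight (A := A) (stdBasis R j))
      _ = ∑' k : basisIndex R × basisIndex A,
            ENNReal.ofReal (‖S (tmulRight (stdBasis R k.1) (stdBasis A k.2))‖ ^ 2) :=
          (ENNReal.tsum_prod (f := fun j i =>
            ENNReal.ofReal (‖S (tmulRight (stdBasis R j) (stdBasis A i))‖ ^ 2))).symm
      _ ≤ hsSq S := tsum_norm_sq_le_hsSq
          (orthonormal_tmulRight (stdBasis A).orthonormal (stdBasis R).orthonormal) S
      _ = 1 := by rw [hS, hω.2]
  have := ENNReal.summable_toReal (hle.trans_lt ENNReal.one_lt_top).ne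
  simpa only [ENNReal.toReal_ofReal (sq_nonneg _)] using this

theorem IsState.partialTrace_mix {ω ω' : HTensor A R →L[ℂ] HTensor A R} (hω : IsState ω)
    (hω' : IsState ω') (p q : ℂ) :
    partialTrace (p • ω + q • ω') = p • partialTrace ω + q • partialTrace ω' := by
  rw [partialTrace, partialTrace, partialTrace, ← hω.summable_partialTrace.tsum_const_smul,
    ← hω'.summable_partialTrace.tsum_const_smul,
    ← (hω.summable_partialTrace.const_smul p).tsum_add (hω'.summable_partialTrace.const_smul q)]
  refine tsum_congr fun j => ?_
  ext x
  simp

theorem partialTrace_rankOne_tmulRight (j : basisIndex R) (φ : A) :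
    partialTrace (InnerProductSpace.rankOne ℂ (tmulRight (stdBasis R j) φ)
      (tmulRight (stdBasis R j) φ)) = InnerProductSpace.rankOne ℂ φ φ := by
  classical
  have h := orthonormal_iff_ite.1 (stdBasis R).orthonormal
  rw [partialTrace, tsum_eq_single j]
  · rw [InnerProductSpace.rankOne_comp, InnerProductSpace.comp_rankOne,
      adjoint_tmulRight_apply_tmulRight, h, if_pos rfl, one_smul]
  · intro i hi
    rw [InnerProductSpace.rankOne_comp, InnerProductSpace.comp_rankOne,
      adjoint_tmulRight_apply_tmulRight, h, if_neg hi, zero_smul]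
    simp

end PartialTrace

/-! ### Energy -/

section Energy

variable {A : Type*} [NormedAddCommGroup A] [InnerProductSpace ℂ A] [CompleteSpace A]

theorem energy_mix_le (G : A →ₗ.[ℂ] A) (ρ σ : A →L[ℂ] A) {p q : ℝ} (hp : 0 ≤ p) (hq : 0 ≤ q) :
    energy G ((p : ℂ) • ρ + (q : ℂ) • σ) ≤
      ENNReal.ofReal p * energy G ρ + ENNReal.ofReal q * energy G σ := by
  refine iSup_le fun K => iSup_le fun hK => iSup_le fun hKG => ?_
  have h : ∀ τ, posTrace (CFC.sqrt K ∘L τ ∘L CFC.sqrt K) ≤ energy G τ := fun τ =>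
    le_iSup_of_le K (le_iSup_of_le hK (le_iSup_of_le hKG le_rfl))
  calc posTrace (CFC.sqrt K ∘L ((p : ℂ) • ρ + (q : ℂ) • σ) ∘L CFC.sqrt K)
      = posTrace ((p : ℂ) • (CFC.sqrt K ∘L ρ ∘L CFC.sqrt K)
          + (q : ℂ) • (CFC.sqrt K ∘L σ ∘L CFC.sqrt K)) := by
        congr 1
        ext x
        simp
    _ ≤ _ := (posTrace_add_le _ _).trans (by
        rw [posTrace_smul hp, posTrace_smul hq]
        gcongr
        exacts [h ρ, h σ])

theorem energy_rankOne_le (G : A →ₗ.[ℂ] A) (φ : G.domain) :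
    energy G (InnerProductSpace.rankOne ℂ (φ : A) (φ : A)) ≤ ENNReal.ofReal (‖(φ : A)‖ * ‖G φ‖) := by
  refine iSup_le fun K => iSup_le fun hK => iSup_le fun hKG => ?_
  have hsa : ContinuousLinearMap.adjoint (CFC.sqrt K) = CFC.sqrt K :=
    (CFC.sqrt_nonneg K).isSelfAdjoint.star_eq
  have hSS : CFC.sqrt K (CFC.sqrt K φ) = K φ := by
    conv_rhs => rw [← CFC.sqrt_mul_sqrt_self K ((ContinuousLinearMap.nonneg_iff_isPositive K).2 hK)]
    rfl
  rw [InnerProductSpace.rankOne_comp, InnerProductSpace.comp_rankOne, hsa, posTrace_rankOne]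
  refine ENNReal.ofReal_le_ofReal ?_
  calc ‖CFC.sqrt K φ‖ ^ 2 = RCLike.re ⟪(φ : A), K φ⟫_ℂ := by
        rw [← hSS, ← hsa, ContinuousLinearMap.adjoint_inner_right, hsa, ← norm_sq_eq_re_inner]
    _ ≤ RCLike.re ⟪(φ : A), G φ⟫_ℂ := hKG φ
    _ ≤ ‖(φ : A)‖ * ‖G φ‖ := re_inner_le_norm _ _

/-- On a composite system that has any state at all there are states of arbitrarily small energy:
the vector states of `φ ⊗ fⱼ` with `‖G φ‖` small. -/
theorem IsHamiltonian.exists_isState_energy_le {G : A →ₗ.[ℂ] A} (hG : IsHamiltonian G) {R : Type*}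
    [NormedAddCommGroup R] [InnerProductSpace ℂ R] [CompleteSpace R]
    {ω : HTensor A R →L[ℂ] HTensor A R} (hω : IsState ω) {ε : ℝ} (hε : 0 < ε) :
    ∃ ω₀ : HTensor A R →L[ℂ] HTensor A R, IsState ω₀ ∧
      energy G (partialTrace ω₀) ≤ ENNReal.ofReal ε := by
  obtain ⟨j⟩ := hω.nonempty_basisIndex
  obtain ⟨φ, hφ, hGφ⟩ := hG.inf_eq_zero ε hε
  refine ⟨InnerProductSpace.rankOne ℂ (tmulRight (stdBasis R j) (φ : A))
    (tmulRight (stdBasis R j) (φ : A)), isState_rankOne ?_, ?_⟩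
  · change ‖(((φ : A) ⊗ₜ[ℂ] stdBasis R j : A ⊗[ℂ] R) : HTensor A R)‖ = 1
    rw [UniformSpace.Completion.norm_coe, TensorProduct.norm_tmul, hφ,
      (stdBasis R).orthonormal.1 j, mul_one]
  · rw [partialTrace_rankOne_tmulRight]
    refine (energy_rankOne_le G φ).trans (ENNReal.ofReal_le_ofReal ?_)
    rw [hφ, one_mul]
    exact hGφ.le

theorem finiteEnergyAR_le (G : A →ₗ.[ℂ] A) (R : Type*) [NormedAddCommGroup R]
    [InnerProductSpace ℂ R] [CompleteSpace R] : FiniteEnergyAR G R ≤ TraceClass (HTensor A R) :=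
  Submodule.span_le.2 fun _ h => h.1.mem_traceClass

end Energy

/-! ### Energy-constrained diamond norms -/

section Maps

variable {A B : Type*} [NormedAddCommGroup A] [InnerProductSpace ℂ A] [CompleteSpace A]
  [NormedAddCommGroup B] [InnerProductSpace ℂ B] [CompleteSpace B] {G : A →ₗ.[ℂ] A}

theorem traceNorm_le_ecdNorm {E : ℝ} {Φ : FiniteEnergy G →ₗ[ℂ] TraceClass B} {R : Type}
    [NormedAddCommGroup R] [InnerProductSpace ℂ R] [CompleteSpace R]
    [TopologicalSpace.SeparableSpace R]
    {Θ : FiniteEnergyAR G R →ₗ[ℂ] TraceClass (HTensor B R)} (hΘ : IsContExtension G Φ Θ)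
    {ω : FiniteEnergyAR G R} (hω : IsState (ω : HTensor A R →L[ℂ] HTensor A R))
    (hE : energy G (partialTrace (ω : HTensor A R →L[ℂ] HTensor A R)) ≤ ENNReal.ofReal E) :
    traceNorm (Θ ω : HTensor B R →L[ℂ] HTensor B R) ≤ ecdNorm G E Φ :=
  le_sSup ⟨R, _, _, _, inferInstance, Θ, ω, hΘ, hω, hE, rfl⟩

theorem ecdNorm_le {E : ℝ} {Φ : FiniteEnergy G →ₗ[ℂ] TraceClass B} {c : ℝ≥0∞}
    (h : ∀ (R : Type) [NormedAddCommGroup R] [InnerProductSpace ℂ R] [CompleteSpace R]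
      [TopologicalSpace.SeparableSpace R]
      (Θ : FiniteEnergyAR G R →ₗ[ℂ] TraceClass (HTensor B R)) (ω : FiniteEnergyAR G R),
      IsContExtension G Φ Θ → IsState (ω : HTensor A R →L[ℂ] HTensor A R) →
      energy G (partialTrace (ω : HTensor A R →L[ℂ] HTensor A R)) ≤ ENNReal.ofReal E →
      traceNorm (Θ ω : HTensor B R →L[ℂ] HTensor B R) ≤ c) : ecdNorm G E Φ ≤ c := by
  refine sSup_le ?_
  rintro _ ⟨R, _, _, _, _, Θ, ω, hΘ, hω, hE, rfl⟩
  exact h R Θ ω hΘ hω hE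

/-- An ECD norm grows at most linearly with the energy: a state of energy `E` is mixed with a state of
small energy, with a weight that brings the energy below `E₀`. -/
theorem ecdNorm_le_mul_ecdNorm (hG : IsHamiltonian G) {E₀ E : ℝ} (hE₀ : 0 < E₀) (hE : 0 < E)
    (Φ : FiniteEnergy G →ₗ[ℂ] TraceClass B) :
    ecdNorm G E Φ ≤ ENNReal.ofReal (4 * (E + E₀) / E₀) * ecdNorm G E₀ Φ := by
  refine ecdNorm_le fun R _ _ _ _ Θ ω hΘ hω hωE => ?_
  obtain ⟨τ, hτ, hτE⟩ := hG.exists_isState_energy_le hω (half_pos hE₀)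
  let ω₀ : FiniteEnergyAR G R :=
    ⟨τ, Submodule.subset_span ⟨hτ, hτE.trans_lt ENNReal.ofReal_lt_top⟩⟩
  set p : ℝ := E₀ / (2 * (E + E₀)) with hp
  have hp0 : 0 < p := by positivity
  have hp1 : p ≤ 1 := by rw [hp, div_le_one (by positivity)]; linarith
  have hpE : p * E ≤ E₀ / 2 := by
    rw [hp, div_mul_eq_mul_div, div_le_div_iff₀ (by positivity) two_pos]
    nlinarith
  have hpc : p⁻¹ * 2 = 4 * (E + E₀) / E₀ := by
    rw [hp]
    field_simp
    ring
  let μ : FiniteEnergyAR G R := (p : ℂ) • ω + ((1 - p : ℝ) : ℂ) • ω₀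
  have hμ : IsState (μ : HTensor A R →L[ℂ] HTensor A R) :=
    hω.mix hτ hp0.le (sub_nonneg.2 hp1) (by ring)
  have hμE : energy G (partialTrace (μ : HTensor A R →L[ℂ] HTensor A R)) ≤ ENNReal.ofReal E₀ := by
    calc _ = energy G ((p : ℂ) • partialTrace (ω : HTensor A R →L[ℂ] HTensor A R)
            + ((1 - p : ℝ) : ℂ) • partialTrace τ) := by
          rw [← hω.partialTrace_mix hτ]; rfl
      _ ≤ ENNReal.ofReal p * ENNReal.ofReal E + ENNReal.ofReal (1 - p) * ENNReal.ofReal (E₀ / 2) :=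
          (energy_mix_le G _ _ hp0.le (sub_nonneg.2 hp1)).trans (by gcongr)
      _ ≤ ENNReal.ofReal E₀ := by
          rw [← ENNReal.ofReal_mul hp0.le, ← ENNReal.ofReal_mul (sub_nonneg.2 hp1),
            ← ENNReal.ofReal_add (by positivity)
              (mul_nonneg (sub_nonneg.2 hp1) (half_pos hE₀).le)]
          refine ENNReal.ofReal_le_ofReal ?_
          nlinarith
  have hτE₀ : energy G (partialTrace (ω₀ : HTensor A R →L[ℂ] HTensor A R)) ≤ ENNReal.ofReal E₀ :=
    hτE.trans (ENNReal.ofReal_le_ofReal (half_le_self hE₀.le))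
  have hΘμ : (Θ μ : HTensor B R →L[ℂ] HTensor B R) =
      (p : ℂ) • (Θ ω : HTensor B R →L[ℂ] HTensor B R)
      + ((1 - p : ℝ) : ℂ) • (Θ ω₀ : HTensor B R →L[ℂ] HTensor B R) := by
    rw [← Submodule.coe_smul, ← Submodule.coe_smul, ← Submodule.coe_add, ← map_smul, ← map_smul,
      ← map_add]
  calc traceNorm (Θ ω : HTensor B R →L[ℂ] HTensor B R)
      ≤ ENNReal.ofReal p⁻¹ * (traceNorm (Θ μ : HTensor B R →L[ℂ] HTensor B R) +
          traceNorm (Θ ω₀ : HTensor B R →L[ℂ] HTensor B R)) := by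
        rw [hΘμ]
        exact traceNorm_le_of_mix _ _ hp0 hp1
    _ ≤ ENNReal.ofReal p⁻¹ * (ecdNorm G E₀ Φ + ecdNorm G E₀ Φ) :=
        mul_le_mul' le_rfl (add_le_add (traceNorm_le_ecdNorm hΘ hμ hμE)
          (traceNorm_le_ecdNorm hΘ hτ hτE₀))
    _ = ENNReal.ofReal (4 * (E + E₀) / E₀) * ecdNorm G E₀ Φ := by
        rw [← two_mul, ← mul_assoc, ← hpc, ENNReal.ofReal_mul (inv_pos.2 hp0).le,
          ENNReal.ofReal_ofNat]

/-- The extension of the completely bounded map is trace-norm Lipschitz, so subtracting it preserves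
continuity on the energy balls. -/
theorem IsContExtension.sub_restrict {R : Type} [NormedAddCommGroup R] [InnerProductSpace ℂ R]
    [CompleteSpace R] {Φ : FiniteEnergy G →ₗ[ℂ] TraceClass B}
    {Θ : FiniteEnergyAR G R →ₗ[ℂ] TraceClass (HTensor B R)} (hΘ : IsContExtension G Φ Θ)
    {Ψ : TraceClass A →ₗ[ℂ] TraceClass B}
    {Ξ : TraceClass (HTensor A R) →ₗ[ℂ] TraceClass (HTensor B R)} (hΞ : ExtendsTensorId Ψ Ξ)
    {C : ℝ≥0} (hC : ∀ ω, traceNorm (Ξ ω : HTensor B R →L[ℂ] HTensor B R) ≤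
      C * traceNorm (ω : HTensor A R →L[ℂ] HTensor A R)) :
    IsContExtension G (Φ - restrict G Ψ) (Θ - Ξ ∘ₗ Submodule.inclusion (finiteEnergyAR_le G R)) where
  extends_tensor ρ σ ω hω := by
    have h1 := hΘ.extends_tensor ρ σ ω hω
    have h2 := hΞ (Submodule.inclusion (finiteEnergy_le G) ρ) σ
      (Submodule.inclusion (finiteEnergyAR_le G R) ω) hω
    rw [LinearMap.sub_apply, LinearMap.sub_apply, Submodule.coe_sub, Submodule.coe_sub,
      tensorOp_sub, LinearMap.comp_apply, h1, h2]
    rfl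
  continuous E hE ω hω ε hε := by
    obtain ⟨δ, hδ, h⟩ := hΘ.continuous E hE ω hω (ε / 2) (ENNReal.half_pos hε.ne')
    have hC0 : (C : ℝ≥0∞) + 1 ≠ 0 := by simp
    have hCt : (C : ℝ≥0∞) + 1 ≠ ∞ := by simp
    refine ⟨min δ (ε / 2 / (C + 1)),
      lt_min hδ (ENNReal.div_pos (ENNReal.half_pos hε.ne').ne' hCt), fun ω' hω' hlt => ?_⟩
    have h1 := h ω' hω' (hlt.trans_le (min_le_left _ _))
    have h2 := (ENNReal.lt_div_iff_mul_lt (Or.inl hC0) (Or.inl hCt)).1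
      (hlt.trans_le (min_le_right _ _))
    let Ξ' := Ξ ∘ₗ Submodule.inclusion (finiteEnergyAR_le G R)
    have h3 : traceNorm (Ξ' (ω' - ω) : HTensor B R →L[ℂ] HTensor B R) < ε / 2 := by
      refine (hC _).trans_lt (lt_of_le_of_lt ?_ h2)
      rw [mul_comm]
      exact mul_le_mul' le_rfl le_self_add
    have h4 : (Θ - Ξ') ω' - (Θ - Ξ') ω = Θ ω' - Θ ω - Ξ' (ω' - ω) := by
      rw [← map_sub, ← map_sub, LinearMap.sub_apply]
    rw [h4, Submodule.coe_sub, ← ENNReal.add_halves ε]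
    exact (traceNorm_sub_le _ _).trans_lt (ENNReal.add_lt_add h1 h3)

theorem ecdNorm_le_add_ecdNorm_sub {Ψ : TraceClass A →ₗ[ℂ] TraceClass B}
    (hΨ : CompletelyBounded Ψ) : ∃ C : ℝ≥0, ∀ (E : ℝ) (Φ : FiniteEnergy G →ₗ[ℂ] TraceClass B),
      ecdNorm G E Φ ≤ C + ecdNorm G E (Φ - restrict G Ψ) := by
  obtain ⟨C, hC⟩ := hΨ
  refine ⟨C, fun E Φ => ecdNorm_le fun R _ _ _ _ Θ ω hΘ hω hωE => ?_⟩
  obtain ⟨Ξ, hΞ, hΞC⟩ := hC R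
  let ω' := Submodule.inclusion (finiteEnergyAR_le G R) ω
  have h1 : traceNorm (Ξ ω' : HTensor B R →L[ℂ] HTensor B R) ≤ C := by
    refine (hΞC ω').trans_eq ?_
    have : traceNorm (ω' : HTensor A R →L[ℂ] HTensor A R) = 1 := by
      rw [← hω.2]
      exact traceNorm_of_nonneg ((ContinuousLinearMap.nonneg_iff_isPositive _).2 hω.1)
    rw [this, mul_one]
  have h2 := traceNorm_le_ecdNorm (hΘ.sub_restrict hΞ hΞC) hω hωE
  have h3 : (Θ ω : HTensor B R →L[ℂ] HTensor B R) = (Ξ ω' : HTensor B R →L[ℂ] HTensor B R) +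
      (((Θ - Ξ ∘ₗ Submodule.inclusion (finiteEnergyAR_le G R)) ω : TraceClass (HTensor B R)) :
        HTensor B R →L[ℂ] HTensor B R) := by
    rw [LinearMap.sub_apply, Submodule.coe_sub]
    exact (add_sub_cancel _ _).symm
  rw [h3]
  exact (traceNorm_add_le _ _).trans (add_le_add h1 h2)

end Maps

end ECD

theorem proposition5
    {A B : Type*} [NormedAddCommGroup A] [InnerProductSpace ℂ A] [CompleteSpace A]
    [TopologicalSpace.SeparableSpace A]
    [NormedAddCommGroup B] [InnerProductSpace ℂ B] [CompleteSpace B]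
    [TopologicalSpace.SeparableSpace B]
    (G : A →ₗ.[ℂ] A) (hG : ECD.IsHamiltonian G) (E₀ : ℝ) (hE₀ : 0 < E₀)
    (Φ : ECD.FiniteEnergy G →ₗ[ℂ] ECD.TraceClass B) (hΦ : Φ ∈ ECD.YCompletion B G E₀) :
    (∀ E : ℝ, 0 < E → ECD.ecdNorm G E Φ < ⊤) ∧
      (fun E : ℝ => (ECD.ecdNorm G E Φ).toReal) =o[Filter.atTop] (fun E : ℝ => E) := by
  obtain ⟨-, Ψ, hΨ, hlim⟩ := hΦ
  have key : ∀ ε : ℝ, 0 < ε → ∃ C : ℝ≥0, ∀ E : ℝ, 0 < E → ECD.ecdNorm G E Φ ≤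
      ENNReal.ofReal (C + 4 * (E + E₀) / E₀ * ε) := fun ε hε => by
    obtain ⟨n, hn⟩ := (hlim.eventually_lt_const (ENNReal.ofReal_pos.2 hε)).exists
    obtain ⟨C, hC⟩ := ECD.ecdNorm_le_add_ecdNorm_sub (G := G) (hΨ n).2
    refine ⟨C, fun E hE => (hC E Φ).trans ?_⟩
    rw [ENNReal.ofReal_add C.coe_nonneg (by positivity), ENNReal.ofReal_coe_nnreal,
      ENNReal.ofReal_mul (by positivity)]
    gcongr
    exact (ECD.ecdNorm_le_mul_ecdNorm hG hE₀ hE _).trans (by gcongr)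
  refine ⟨fun E hE => ?_, ?_⟩
  · obtain ⟨C, hC⟩ := key 1 one_pos
    exact (hC E hE).trans_lt ENNReal.ofReal_lt_top
  · rw [Asymptotics.isLittleO_iff]
    intro c hc
    -- With this `ε` the linear term is `(c / 2) (E + E₀)`.
    obtain ⟨C, hC⟩ := key (c * E₀ / 8) (by positivity)
    filter_upwards [Filter.eventually_gt_atTop 0,
      Filter.eventually_ge_atTop ((C + c / 2 * E₀) / (c / 2))] with E hE hE'
    rw [Real.norm_of_nonneg ENNReal.toReal_nonneg, Real.norm_of_nonneg hE.le]
    refine (ENNReal.toReal_le_of_le_ofReal (by positivity) (hC E hE)).trans ?_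
    rw [div_le_iff₀ (by positivity)] at hE'
    have : 4 * (E + E₀) / E₀ * (c * E₀ / 8) = c / 2 * (E + E₀) := by field_simp; ring
    rw [this]
    linarith
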